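/- Fix $p\in\mathbb N$. For each sample size $n$ let $X=X_n\in\mathbb R^{n\times p}$ be a deterministic design matrix with rows $x_1,\dots,x_n$, such that $$C_n:=\tfrac1n X^\top X\to C\succ O,\qquad \tfrac1n\max_{i}\|x_i\|_2^2\to 0\qquad(n\to\infty),$$ and let $y=X\beta^*+\varepsilon$, where $\beta^*\in\mathbb R^p$ is the fixed true parameter and $\varepsilon\in\mathbb R^n$ has i.i.d. $\mathcal N(0,\sigma^2)$ entries. Let $\tilde\beta\in\mathbb R^p$ be a fixed (deterministic) source parameter, and let $\lambda_n,\eta_n$ be real sequences of regularization parameters. Let $\hat\beta=\hat\beta_n$ be a Transfer Lasso estimator, i.e. a (measurable) random vector with $$\hat\beta_n\in\operatorname*{argmin}_{\beta\in\mathbb R^p}\Big\{\tfrac1n\|y-X\beta\|_2^2+\tfrac{\lambda_n}{n}\sum_{j=1}^p|\beta_j|+\tfrac{\eta_n}{n}\sum_{j=1}^p|\beta_j-\tilde\beta_j|\Big\}.$$ Put $$S:=\{j:\beta^*_j\ne0\},\quad T:=\{j:\tilde\beta_j\ne\beta^*_j\},\quad \hat S_n:=\{j:\hat\beta_j\neq0\},\quad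 \hat T_n:=\{j:\hat\beta_j\neq\tilde\beta_j\}.$$ **Theorem (oracle property of the Transfer Lasso, deterministic source parameter).** Suppose that $S=T$ and that $\operatorname{sgn}(\tilde\beta_j-\beta^*_j)=\operatorname{sgn}(\beta^*_j)$ for all $j\in S$. If $(\lambda_n+\eta_n)/\sqrt n\to\infty$ and $(\lambda_n-\eta_n)/\sqrt n\to0$, then $$\lim_{n\to\infty}P(\hat S_n=S)=\lim_{n\to\infty}P(\hat T_n=T)=1$$ and $$\sqrt n\,(\hat\beta_S-\beta^*_S)\overset{d}{\to}\mathcal N(0,\sigma^2C_{SS}^{-1}),$$ where $v_S$ denotes the restriction of a vector to the indices in $S$ and $C_{SS}$ the submatrix of $C$ with rows and columns in $S$. -/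

import Mathlib

open Filter Topology MeasureTheory ProbabilityTheory
open scoped Matrix NNReal

/-- The active set (support) `{j : β j ≠ 0}` of a parameter vector. -/
noncomputable def activeSet {p : ℕ} (β : EuclideanSpace ℝ (Fin p)) : Finset (Fin p) :=
  {j | β j ≠ 0}

/-- The change set `{j : β' j ≠ β j}` of coordinates in which `β` differs from the source
parameter `β'`. -/
noncomputable def changeSet {p : ℕ} (β' β : EuclideanSpace ℝ (Fin p)) : Finset (Fin p) :=
  {j | β' j ≠ β j}

/-- The restriction `v_S` of a vector to the index set `S`. -/
noncomputable def restrictTo {p : ℕ} (S : Finset (Fin p)) (v : EuclideanSpace ℝ (Fin p)) :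
    EuclideanSpace ℝ S :=
  WithLp.toLp 2 fun j : S => v j

/-- The principal submatrix `M_SS`. -/
def principalSubmatrix {p : ℕ} (S : Finset (Fin p)) (M : Matrix (Fin p) (Fin p) ℝ) :
    Matrix S S ℝ :=
  M.submatrix (fun j : S => (j : Fin p)) (fun j : S => (j : Fin p))

/-- The response `y = X β + ε` of the linear model. -/
noncomputable def linearResponse {n p : ℕ} (X : Matrix (Fin n) (Fin p) ℝ)
    (β : EuclideanSpace ℝ (Fin p)) (ε : EuclideanSpace ℝ (Fin n)) : EuclideanSpace ℝ (Fin n) :=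
  WithLp.toLp 2 (X *ᵥ β) + ε

/-- The Transfer Lasso objective
`(1/n) ‖y - X β‖₂² + (lam/n) ∑ |β j| + (eta/n) ∑ |β j - β' j|`, with source parameter `β'`. -/
noncomputable def transferLassoObjective {n p : ℕ} (X : Matrix (Fin n) (Fin p) ℝ)
    (y : EuclideanSpace ℝ (Fin n)) (β' : EuclideanSpace ℝ (Fin p)) (lam eta : ℝ)
    (β : EuclideanSpace ℝ (Fin p)) : ℝ :=
  1 / (n : ℝ) * ‖y - WithLp.toLp 2 (X *ᵥ β)‖ ^ 2
    + lam / (n : ℝ) * ∑ j, |β j|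
    + eta / (n : ℝ) * ∑ j, |β j - β' j|

/-- `b` is a Transfer Lasso estimate: a global minimizer of the Transfer Lasso objective. -/
def IsTransferLasso {n p : ℕ} (X : Matrix (Fin n) (Fin p) ℝ) (y : EuclideanSpace ℝ (Fin n))
    (β' : EuclideanSpace ℝ (Fin p)) (lam eta : ℝ) (b : EuclideanSpace ℝ (Fin p)) : Prop :=
  ∀ β : EuclideanSpace ℝ (Fin p),
    transferLassoObjective X y β' lam eta b ≤ transferLassoObjective X y β' lam eta β

/-! Put `u = √n (β̂ - β*)`, `w = Xᵀ ε / √n` and `A = Xᵀ X / n`. Then `u` minimizes `u ⬝ A u - 2 w ⬝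
u` plus a coordinatewise penalty. Off `S` both `β*` and `β̃` vanish, so the two kinks coincide and
the penalty is `(λ + η) / √n * |u j|`, with diverging weight. On `S` the source value lies beyond
`β* j`, on the side away from zero, so the two penalty terms have opposite slopes near `β* j`. There
the penalty is linear with slope `a * s j`, where `a = (λ - η) / √n → 0` and `s j = sgn (β* j)`, up
to a distance of order `√n`; by convexity it lies above that line everywhere.

On the event `max |w j| ≤ M` the rest is deterministic for large `n`. Positive definiteness confines
`u` to a fixed `ℓ¹` ball (`sum_abs_le_of_penalizedQuadratic_min`), the diverging weight kills `u`
off `S` (`eq_zero_of_penalizedQuadratic_min`), and the first order condition on `S` reads `A_SS u_S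
= w_S - (a / 2) s_S`. Both sets are recovered because `u` is bounded while `√n |β* j|` and `√n |β̃ j
- β* j|` diverge on `S` (`IsTransferLasso.oracle`).

Chebyshev bounds the exceptional probability by `O(1 / M ^ 2)` for large `n`, and `M` is arbitrary.
The score is exactly Gaussian with covariance `σ ^ 2 A`, so the characteristic function of
`oracleError` is explicit and its limit can be read off. Replacing the true error by `oracleError`
costs a vanishing amount, and Lévy's continuity theorem concludes. -/

/-- The quadratic `u ⬝ A u - 2 w ⬝ u` plus a coordinatewise penalty. -/
def penalizedQuadratic {ι : Type*} [Fintype ι] (A : Matrix ι ι ℝ) (w : ι → ℝ) (pen : ι → ℝ → ℝ)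
    (u : ι → ℝ) : ℝ :=
  u ⬝ᵥ A *ᵥ u - 2 * (w ⬝ᵥ u) + ∑ j, pen j (u j)

/-! ### Minimizers of penalized quadratics -/

section PenalizedQuadratic

variable {ι : Type*} [Fintype ι]

lemma penalizedQuadratic_add_single [DecidableEq ι] {A : Matrix ι ι ℝ} (hA : A.IsSymm)
    (w : ι → ℝ) (pen : ι → ℝ → ℝ) (u : ι → ℝ) (j : ι) (t : ℝ) :
    penalizedQuadratic A w pen (u + Pi.single j t) - penalizedQuadratic A w pen u =
      2 * t * ((A *ᵥ u) j - w j) + t ^ 2 * A j j + pen j (u j + t) - pen j (u j) := by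
  have h1 : u ⬝ᵥ A *ᵥ Pi.single j t = t * (A *ᵥ u) j := by
    rw [Matrix.dotProduct_mulVec, dotProduct_single, ← Matrix.mulVec_transpose, hA.eq, mul_comm]
  have h2 : (Pi.single j t : ι → ℝ) ⬝ᵥ A *ᵥ Pi.single j t = t ^ 2 * A j j := by
    rw [single_dotProduct, Matrix.mulVec_single]
    simp
    ring
  have h3 : ∑ k, pen k ((u + Pi.single j t : ι → ℝ) k) - ∑ k, pen k (u k)
      = pen j (u j + t) - pen j (u j) := by
    rw [← Finset.sum_sub_distrib, Finset.sum_eq_single j]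
    · simp
    · intro k _ hk
      simp [hk]
    · simp
  have h4 : penalizedQuadratic A w pen (u + Pi.single j t) - penalizedQuadratic A w pen u =
      u ⬝ᵥ A *ᵥ Pi.single j t + (Pi.single j t : ι → ℝ) ⬝ᵥ A *ᵥ u
        + (Pi.single j t : ι → ℝ) ⬝ᵥ A *ᵥ Pi.single j t - 2 * (w ⬝ᵥ Pi.single j t)
        + (∑ k, pen k ((u + Pi.single j t : ι → ℝ) k) - ∑ k, pen k (u k)) := by
    simp only [penalizedQuadratic, Matrix.mulVec_add, dotProduct_add, add_dotProduct]
    ring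
  rw [h4, h3, h1, h2, single_dotProduct, dotProduct_single]
  ring

lemma abs_dotProduct_le_mul_sum_abs {w : ι → ℝ} {M : ℝ} (hw : ∀ j, |w j| ≤ M) (u : ι → ℝ) :
    |w ⬝ᵥ u| ≤ M * ∑ j, |u j| := by
  rw [dotProduct, Finset.mul_sum]
  refine (Finset.abs_sum_le_sum_abs _ _).trans (Finset.sum_le_sum fun j _ => ?_)
  rw [abs_mul]
  exact mul_le_mul_of_nonneg_right (hw j) (abs_nonneg _)

lemma abs_dotProduct_mulVec_le {A : Matrix ι ι ℝ} {K : ℝ} (hA : ∀ i j, |A i j| ≤ K)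
    (u : ι → ℝ) : |u ⬝ᵥ A *ᵥ u| ≤ K * (∑ j, |u j|) ^ 2 := by
  rw [dotProduct_comm]
  refine (abs_dotProduct_le_mul_sum_abs
    (fun i => abs_dotProduct_le_mul_sum_abs (hA i) u) u).trans_eq ?_
  ring

/-- A linear function which dominates a quadratic near zero has zero slope. -/
lemma eq_zero_of_forall_abs_lt_nonneg {g q r : ℝ} (hr : 0 < r)
    (h : ∀ t, |t| < r → 0 ≤ g * t + q * t ^ 2) : g = 0 := by
  have hmin : IsLocalMin (fun t : ℝ => g * t + q * t ^ 2) 0 := by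
    filter_upwards [Metric.ball_mem_nhds (0 : ℝ) hr] with t ht
    have := h t (by simpa using ht)
    simpa using this
  have hd : HasDerivAt (fun t : ℝ => g * t + q * t ^ 2)
      (g * 1 + q * (((2 : ℕ) : ℝ) * 0 ^ (2 - 1) * 1)) 0 :=
    ((hasDerivAt_id (0 : ℝ)).const_mul g).add (((hasDerivAt_id (0 : ℝ)).pow 2).const_mul q)
  simpa using hmin.hasDerivAt_eq_zero hd

variable {A : Matrix ι ι ℝ} {w s : ι → ℝ} {pen : ι → ℝ → ℝ} {S : Finset ι} {a b c K M ρ : ℝ}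
  {u : ι → ℝ}

/-- A minimizer of the penalized quadratic lies in a fixed `ℓ¹` ball. -/
lemma sum_abs_le_of_penalizedQuadratic_min (hs : ∀ j, |s j| ≤ 1) (ha : |a| ≤ 1)
    (hb : 0 ≤ b) (hc : 0 < c) (hM : 0 ≤ M) (hAc : ∀ v : ι → ℝ, c * (∑ j, |v j|) ^ 2 ≤ v ⬝ᵥ A *ᵥ v)
    (hw : ∀ j, |w j| ≤ M) (hpen0 : ∀ j, pen j 0 = 0)
    (hpenS : ∀ j ∈ S, ∀ x, a * s j * x ≤ pen j x) (hpenSc : ∀ j ∉ S, ∀ x, pen j x = b * |x|)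
    (hu : ∀ v, penalizedQuadratic A w pen u ≤ penalizedQuadratic A w pen v) :
    ∑ j, |u j| ≤ (2 * M + 1) / c := by
  have h0 : penalizedQuadratic A w pen u ≤ 0 := by
    simpa [penalizedQuadratic, hpen0] using hu 0
  have h1 : -∑ j, |u j| ≤ ∑ j, pen j (u j) := by
    rw [← Finset.sum_neg_distrib]
    refine Finset.sum_le_sum fun j _ => ?_
    by_cases hj : j ∈ S
    · refine le_trans ?_ (hpenS j hj _)
      refine neg_le_of_abs_le ?_
      rw [abs_mul, abs_mul]
      calc |a| * |s j| * |u j| ≤ 1 * 1 * |u j| := by gcongr; exact hs j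
        _ = |u j| := by ring
    · rw [hpenSc j hj]
      have := mul_nonneg hb (abs_nonneg (u j))
      linarith [abs_nonneg (u j)]
  have h2 := (abs_le.1 (abs_dotProduct_le_mul_sum_abs hw u)).2
  have h3 := hAc u
  unfold penalizedQuadratic at h0
  have hN : 0 ≤ ∑ j, |u j| := Finset.sum_nonneg fun _ _ => abs_nonneg _
  rw [le_div_iff₀ hc]
  rcases hN.eq_or_lt with hN | hN
  · rw [← hN]; linarith
  -- With `N = ∑ j, |u j|`, comparison with `0` gives `c * N ^ 2 ≤ 2 * M * N + N`; the last `N` pays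
  -- for the slopes `a * s j`, of size at most one. Divide by `N`.
  · refine le_of_mul_le_mul_right ?_ hN
    nlinarith

/-- A strong `ℓ¹` penalty forces coordinates of a bounded minimizer to vanish. -/
lemma eq_zero_of_penalizedQuadratic_min (hA : A.IsSymm) {R : ℝ} (hK : ∀ i j, |A i j| ≤ K)
    (hw : ∀ j, |w j| ≤ M) (hR : ∑ j, |u j| ≤ R) (hb : 3 * (K * R) + 2 * M < b) {j : ι}
    (hpen : ∀ x, pen j x = b * |x|)
    (hu : ∀ v, penalizedQuadratic A w pen u ≤ penalizedQuadratic A w pen v) :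
    u j = 0 := by
  classical
  by_contra hne
  have hpos : 0 < |u j| := abs_pos.2 hne
  -- Resetting coordinate `j` to zero saves `b * |u j|`. The quadratic part changes by at most `|u
  -- j|` times `K * R` (diagonal) plus `2 * (K * R)` (from `A *ᵥ u`) plus `2 * M` (from `w`).
  have h := penalizedQuadratic_add_single hA w pen u j (-u j)
  have h' := hu (u + Pi.single j (-u j))
  simp only [hpen, add_neg_cancel, abs_zero] at h
  have hK0 : 0 ≤ K := (abs_nonneg _).trans (hK j j)
  have h1 : |(A *ᵥ u) j| ≤ K * R :=
    (abs_dotProduct_le_mul_sum_abs (hK j) u).trans (by gcongr)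
  have hjR : |u j| ≤ R :=
    (Finset.single_le_sum (f := fun k => |u k|) (fun _ _ => abs_nonneg _)
      (Finset.mem_univ j)).trans hR
  have h2 : |2 * -u j * ((A *ᵥ u) j - w j) + (-u j) ^ 2 * A j j|
      ≤ |u j| * (3 * (K * R) + 2 * M) := by
    have e : 2 * -u j * ((A *ᵥ u) j - w j) + (-u j) ^ 2 * A j j
        = u j * (u j * A j j - 2 * (A *ᵥ u) j + 2 * w j) := by ring
    rw [e, abs_mul]
    refine mul_le_mul_of_nonneg_left ?_ hpos.le
    have h3 : |u j * A j j| ≤ K * R := by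
      rw [abs_mul, mul_comm]
      exact mul_le_mul (hK j j) hjR (abs_nonneg _) hK0
    have hwj := hw j
    rw [abs_le] at *
    constructor <;> linarith [h1.1, h1.2, h3.1, h3.2, hwj.1, hwj.2]
  have h4 := (abs_le.1 h2).2
  have h5 := mul_lt_mul_of_pos_left hb hpos
  nlinarith

/-- First order condition at coordinates where the penalty is locally linear. -/
lemma mulVec_eq_of_penalizedQuadratic_min (hA : A.IsSymm) {j : ι} (huj : |u j| < ρ)
    (hpen : ∀ x, |x| < ρ → pen j x = a * s j * x)
    (hu : ∀ v, penalizedQuadratic A w pen u ≤ penalizedQuadratic A w pen v) :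
    (A *ᵥ u) j = w j - a / 2 * s j := by
  classical
  have hg : 2 * ((A *ᵥ u) j - w j) + a * s j = 0 := by
    -- A step shorter than `ρ - |u j|` stays where the penalty is linear.
    refine eq_zero_of_forall_abs_lt_nonneg (q := A j j) (sub_pos.2 huj) fun t ht => ?_
    have h := penalizedQuadratic_add_single hA w pen u j t
    have h' := hu (u + Pi.single j t)
    rw [hpen _ huj, hpen _ ((abs_add_le _ _).trans_lt (by linarith))] at h
    nlinarith
  linarith

end PenalizedQuadratic

/-! ### Uniform bounds for matrices near a positive definite limit -/

/-- A positive definite matrix dominates the squared `ℓ¹` norm. -/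
lemma Matrix.PosDef.exists_mul_sq_sum_abs_le {ι : Type*} [Fintype ι] {C : Matrix ι ι ℝ}
    (hC : C.PosDef) : ∃ c > 0, ∀ u : ι → ℝ, c * (∑ j, |u j|) ^ 2 ≤ u ⬝ᵥ C *ᵥ u := by
  classical
  have hcont : Continuous fun u : ι → ℝ => u ⬝ᵥ C *ᵥ u := by
    unfold dotProduct Matrix.mulVec dotProduct
    fun_prop
  -- The form attains a positive minimum on the compact `ℓ¹` sphere, and scaling does the rest. The
  -- sphere is empty when `ι` is.
  set Q : Set (ι → ℝ) := {u | ∑ j, |u j| = 1} with hQ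
  have hcl : IsClosed Q := isClosed_eq (by fun_prop) continuous_const
  have hbd : Bornology.IsBounded Q := by
    refine (Metric.isBounded_closedBall (x := (0 : ι → ℝ)) (r := 1)).subset fun u hu => ?_
    rw [mem_closedBall_zero_iff, pi_norm_le_iff_of_nonneg zero_le_one]
    intro j
    have hu : ∑ j, |u j| = 1 := hu
    rw [Real.norm_eq_abs, ← hu]
    exact Finset.single_le_sum (f := fun k => |u k|) (fun _ _ => abs_nonneg _) (Finset.mem_univ j)
  have hcomp : IsCompact Q := Metric.isCompact_of_isClosed_isBounded hcl hbd
  have key : ∃ c > 0, ∀ u ∈ Q, c ≤ u ⬝ᵥ C *ᵥ u := by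
    rcases Q.eq_empty_or_nonempty with h | h
    · exact ⟨1, one_pos, fun u hu => by simp [h] at hu⟩
    · obtain ⟨v, hv, hmin⟩ := hcomp.exists_isMinOn h hcont.continuousOn
      refine ⟨v ⬝ᵥ C *ᵥ v, ?_, fun u hu => hmin hu⟩
      have hv0 : v ≠ 0 := by
        rintro rfl
        simp [hQ] at hv
      simpa using hC.dotProduct_mulVec_pos hv0
  obtain ⟨c, hc, hcQ⟩ := key
  refine ⟨c, hc, fun u => ?_⟩
  have hN : 0 ≤ ∑ j, |u j| := Finset.sum_nonneg fun _ _ => abs_nonneg _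
  rcases hN.eq_or_lt with hN | hN
  · have hu : u = 0 := by
      funext j
      simpa using (Finset.sum_eq_zero_iff_of_nonneg fun _ _ => abs_nonneg _).1 hN.symm j
        (Finset.mem_univ j)
    simp [hu]
  · set N := ∑ j, |u j|
    have hm : N⁻¹ • u ∈ Q := by
      simp only [hQ, Set.mem_ofPred_eq, Pi.smul_apply, smul_eq_mul, abs_mul, ← Finset.mul_sum]
      rw [abs_of_pos (inv_pos.2 hN)]
      exact inv_mul_cancel₀ hN.ne'
    have h := hcQ _ hm
    simp only [Matrix.mulVec_smul, dotProduct_smul, smul_dotProduct, smul_eq_mul] at h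
    calc c * N ^ 2 ≤ (N⁻¹ * (N⁻¹ * (u ⬝ᵥ C *ᵥ u))) * N ^ 2 := by gcongr
      _ = u ⬝ᵥ C *ᵥ u := by field_simp

/-- Entrywise convergence to a positive definite matrix preserves, up to a constant, domination of
the squared `ℓ¹` norm. -/
lemma Matrix.PosDef.exists_eventually_mul_sq_sum_abs_le {ι α : Type*} [Fintype ι] {l : Filter α}
    {C : Matrix ι ι ℝ} (hC : C.PosDef) {A : α → Matrix ι ι ℝ} (hA : Tendsto A l (𝓝 C)) :
    ∃ c > 0, ∀ᶠ n in l, ∀ u : ι → ℝ, c * (∑ j, |u j|) ^ 2 ≤ u ⬝ᵥ A n *ᵥ u := by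
  obtain ⟨c, hc, h⟩ := hC.exists_mul_sq_sum_abs_le
  refine ⟨c / 2, by positivity, ?_⟩
  -- An entrywise error of `c / 2` costs at most half of the lower bound `c`.
  have hev : ∀ᶠ n in l, ∀ i j, |(A n - C) i j| ≤ c / 2 := by
    refine eventually_all.2 fun i => eventually_all.2 fun j => ?_
    have h1 : Tendsto (fun n => A n i j) l (𝓝 (C i j)) := (hA.apply_nhds i).apply_nhds j
    filter_upwards [Metric.tendsto_nhds.1 h1 (c / 2) (by positivity)] with n hn
    rw [Real.dist_eq] at hn
    simpa using hn.le
  filter_upwards [hev] with n hn u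
  have h1 := (abs_le.1 (abs_dotProduct_mulVec_le hn u)).1
  have h2 := h u
  rw [Matrix.sub_mulVec, dotProduct_sub] at h1
  linarith

lemma exists_eventually_abs_apply_le {ι α : Type*} [Finite ι] {l : Filter α}
    {C : Matrix ι ι ℝ} {A : α → Matrix ι ι ℝ} (hA : Tendsto A l (𝓝 C)) :
    ∃ K, ∀ᶠ n in l, ∀ i j, |A n i j| ≤ K := by
  cases nonempty_fintype ι
  refine ⟨∑ i, ∑ j, (|C i j| + 1), ?_⟩
  refine eventually_all.2 fun i => eventually_all.2 fun j => ?_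
  have h1 : Tendsto (fun n => |A n i j|) l (𝓝 |C i j|) := ((hA.apply_nhds i).apply_nhds j).abs
  filter_upwards [h1.eventually_le_const (lt_add_one _)] with n hn
  refine hn.trans ?_
  refine le_trans ?_ (Finset.single_le_sum (f := fun i => ∑ j, (|C i j| + 1))
    (fun _ _ => by positivity) (Finset.mem_univ i))
  exact Finset.single_le_sum (f := fun j => |C i j| + 1)
    (fun _ _ => by positivity) (Finset.mem_univ j)

/-! ### The rescaled Transfer Lasso problem -/

/-- The normalized score `Xᵀ ε / √n`. -/
noncomputable def normalizedScore {n p : ℕ} (X : Matrix (Fin n) (Fin p) ℝ)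
    (ε : EuclideanSpace ℝ (Fin n)) : Fin p → ℝ :=
  fun j => ∑ i, X i j / √(n : ℝ) * ε i

/-- The increment of the Transfer Lasso penalty when moving from `b` to `b + x / r`. -/
noncomputable def transferPenalty {p : ℕ} (b b' : EuclideanSpace ℝ (Fin p)) (lam eta r : ℝ)
    (j : Fin p) (x : ℝ) : ℝ :=
  lam * (|b j + x / r| - |b j|) + eta * (|b j - b' j + x / r| - |b j - b' j|)

section TransferPenalty

variable {p : ℕ} {b b' : EuclideanSpace ℝ (Fin p)} {lam eta r : ℝ} {j : Fin p}

lemma transferPenalty_of_eq_zero (hr : 0 < r) (hb : b j = 0) (hb' : b' j = 0) (x : ℝ) :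
    transferPenalty b b' lam eta r j x = (lam + eta) / r * |x| := by
  simp only [transferPenalty, hb, hb', sub_zero, zero_add, abs_zero, abs_div, abs_of_pos hr]
  ring

lemma sign_mul_self_le_abs (x y : ℝ) : (SignType.sign x : ℝ) * y ≤ |y| := by
  rcases lt_trichotomy x 0 with h | h | h
  · simp [sign_neg h, neg_le_abs]
  · simp [h]
  · simp [sign_pos h, le_abs_self]

/-- Subgradient inequality for both absolute values: `b j - b' j` has sign opposite to `b j`, so the
two slopes combine to `lam - eta`. -/
lemma le_transferPenalty (hlam : 0 ≤ lam) (heta : 0 ≤ eta)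
    (hsign : SignType.sign (b' j - b j) = SignType.sign (b j)) (x : ℝ) :
    (lam - eta) / r * (SignType.sign (b j) : ℝ) * x ≤ transferPenalty b b' lam eta r j x := by
  have h1 : (SignType.sign (b j) : ℝ) * (x / r) ≤ |b j + x / r| - |b j| := by
    have := sign_mul_self_le_abs (b j) (b j + x / r)
    rw [mul_add, sign_mul_self] at this
    linarith
  have h2 : -(SignType.sign (b j) : ℝ) * (x / r) ≤ |b j - b' j + x / r| - |b j - b' j| := by
    have := sign_mul_self_le_abs (b' j - b j) (b' j - b j - x / r)
    rw [mul_sub, sign_mul_self, hsign] at this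
    rw [abs_sub_comm (b j), ← abs_neg (b j - b' j + x / r),
      show -(b j - b' j + x / r) = b' j - b j - x / r by ring]
    linarith
  have h3 := mul_le_mul_of_nonneg_left h1 hlam
  have h4 := mul_le_mul_of_nonneg_left h2 heta
  calc (lam - eta) / r * (SignType.sign (b j) : ℝ) * x
      = lam * ((SignType.sign (b j) : ℝ) * (x / r))
        + eta * (-(SignType.sign (b j) : ℝ) * (x / r)) := by ring
    _ ≤ _ := add_le_add h3 h4

lemma abs_add_eq_of_abs_lt {x y : ℝ} (h : |y| < |x|) :
    |x + y| - |x| = (SignType.sign x : ℝ) * y := by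
  rcases lt_trichotomy x 0 with hx | hx | hx
  · rw [abs_of_neg hx] at *
    have := abs_lt.1 h
    rw [abs_of_neg (by linarith), sign_neg hx]
    simp
  · simp only [hx, abs_zero] at h
    exact absurd h (abs_nonneg y).not_gt
  · rw [abs_of_pos hx] at *
    have := abs_lt.1 h
    rw [abs_of_pos (by linarith), sign_pos hx]
    simp

/-- The segment from `b j` to `b j + x / r` reaches neither kink, `0` or `b' j`, so both absolute
values are linear on it. -/
lemma transferPenalty_eq_of_abs_lt (hr : 0 < r)
    (hsign : SignType.sign (b' j - b j) = SignType.sign (b j)) {x : ℝ}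
    (hx : |x| < r * |b j|) (hx' : |x| < r * |b' j - b j|) :
    transferPenalty b b' lam eta r j x = (lam - eta) / r * (SignType.sign (b j) : ℝ) * x := by
  have hdiv : ∀ y, |x| < r * |y| → |x / r| < |y| := fun y hy => by
    rwa [abs_div, abs_of_pos hr, div_lt_iff₀' hr]
  have h1 := abs_add_eq_of_abs_lt (hdiv _ hx)
  have h2 := abs_add_eq_of_abs_lt (x := b j - b' j) (y := x / r)
    (by rw [abs_sub_comm]; exact hdiv _ hx')
  have h3 : (SignType.sign (b j - b' j) : ℝ) = -(SignType.sign (b j) : ℝ) := by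
    rw [← hsign, ← neg_sub (b' j), Left.sign_neg]
    simp
  rw [transferPenalty, h1, h2, h3]
  ring

end TransferPenalty

/-- The residual at the shifted point is `ε - X u / √n`; expanding its square gives the quadratic,
and `‖ε‖ ^ 2` cancels. -/
lemma mul_transferLassoObjective_sub {n p : ℕ} (hn : 0 < n) (X : Matrix (Fin n) (Fin p) ℝ)
    (βs βt : EuclideanSpace ℝ (Fin p)) (ε : EuclideanSpace ℝ (Fin n)) (lam eta : ℝ)
    (u : Fin p → ℝ) :
    (n : ℝ) * (transferLassoObjective X (linearResponse X βs ε) βt lam eta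
        (βs + WithLp.toLp 2 ((√(n : ℝ))⁻¹ • u))
      - transferLassoObjective X (linearResponse X βs ε) βt lam eta βs) =
    penalizedQuadratic ((1 / (n : ℝ)) • (Xᵀ * X)) (normalizedScore X ε)
      (transferPenalty βs βt lam eta √(n : ℝ)) u := by
  have hn' : (0 : ℝ) < n := by exact_mod_cast hn
  have hr : (0 : ℝ) < √(n : ℝ) := Real.sqrt_pos.2 hn'
  have hrr : (√(n : ℝ))⁻¹ * (√(n : ℝ))⁻¹ = 1 / n := by
    rw [← mul_inv, Real.mul_self_sqrt hn'.le, one_div]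
  have e1 : linearResponse X βs ε - WithLp.toLp 2 (X *ᵥ βs) = ε := by
    rw [linearResponse, add_sub_cancel_left]
  have e2 : linearResponse X βs ε
      - WithLp.toLp 2 (X *ᵥ (βs + WithLp.toLp 2 ((√(n : ℝ))⁻¹ • u)).ofLp)
      = ε - (√(n : ℝ))⁻¹ • WithLp.toLp 2 (X *ᵥ u) := by
    rw [linearResponse]
    ext i
    simp [Matrix.mulVec_add, Matrix.mulVec_smul]
  have e3 : inner ℝ ε (WithLp.toLp 2 (X *ᵥ u)) = √(n : ℝ) * (normalizedScore X ε ⬝ᵥ u) := by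
    simp only [normalizedScore, PiLp.inner_apply, dotProduct, Matrix.mulVec, Finset.sum_mul,
      Finset.mul_sum]
    rw [Finset.sum_comm]
    refine Finset.sum_congr rfl fun i _ => ?_
    simp only [RCLike.inner_apply, conj_trivial, Finset.sum_mul]
    refine Finset.sum_congr rfl fun j _ => ?_
    field_simp
  have e4 : ‖WithLp.toLp 2 (X *ᵥ u)‖ ^ 2 = u ⬝ᵥ (Xᵀ * X) *ᵥ u := by
    rw [EuclideanSpace.real_norm_sq_eq, ← Matrix.mulVec_mulVec, Matrix.dotProduct_mulVec,
      Matrix.vecMul_transpose]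
    simp [dotProduct, sq]
  have e5 : ‖linearResponse X βs ε
      - WithLp.toLp 2 (X *ᵥ (βs + WithLp.toLp 2 ((√(n : ℝ))⁻¹ • u)).ofLp)‖ ^ 2
      = ‖ε‖ ^ 2 - 2 * (normalizedScore X ε ⬝ᵥ u) + 1 / n * (u ⬝ᵥ (Xᵀ * X) *ᵥ u) := by
    rw [e2, norm_sub_sq_real, inner_smul_right, e3, norm_smul, mul_pow, e4, Real.norm_eq_abs,
      sq_abs, sq (√(n : ℝ))⁻¹, hrr]
    field_simp
  simp only [transferLassoObjective, e5, e1, penalizedQuadratic, transferPenalty,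
    Finset.sum_add_distrib, ← Finset.mul_sum, Finset.sum_sub_distrib, Matrix.smul_mulVec,
    dotProduct_smul, smul_eq_mul, PiLp.add_apply, Pi.smul_apply]
  have e6 : ∀ j, βs j + (√(n : ℝ))⁻¹ * u j - βt j = βs j - βt j + u j / √(n : ℝ) := fun j => by
    ring
  have e7 : ∀ j, βs j + (√(n : ℝ))⁻¹ * u j = βs j + u j / √(n : ℝ) := fun j => by
    ring
  simp only [e6]
  simp only [e7]
  generalize ∑ j, |βs j + u j / √(n : ℝ)| = s₁
  generalize ∑ j, |βs j - βt j + u j / √(n : ℝ)| = s₂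
  field_simp
  ring

lemma IsTransferLasso.penalizedQuadratic_le {n p : ℕ} (hn : 0 < n) {X : Matrix (Fin n) (Fin p) ℝ}
    {βs βt b : EuclideanSpace ℝ (Fin p)} {ε : EuclideanSpace ℝ (Fin n)} {lam eta : ℝ}
    (h : IsTransferLasso X (linearResponse X βs ε) βt lam eta b) (v : Fin p → ℝ) :
    penalizedQuadratic ((1 / (n : ℝ)) • (Xᵀ * X)) (normalizedScore X ε)
        (transferPenalty βs βt lam eta √(n : ℝ)) (√(n : ℝ) • (b - βs).ofLp) ≤
      penalizedQuadratic ((1 / (n : ℝ)) • (Xᵀ * X)) (normalizedScore X ε)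
        (transferPenalty βs βt lam eta √(n : ℝ)) v := by
  have hn' : (0 : ℝ) < n := by exact_mod_cast hn
  have hr : (0 : ℝ) < √(n : ℝ) := Real.sqrt_pos.2 hn'
  have hb : βs + WithLp.toLp 2 ((√(n : ℝ))⁻¹ • √(n : ℝ) • (b - βs).ofLp) = b := by
    rw [smul_smul, inv_mul_cancel₀ hr.ne', one_smul]
    simp
  rw [← mul_transferLassoObjective_sub hn, ← mul_transferLassoObjective_sub hn, hb]
  have := h (βs + WithLp.toLp 2 ((√(n : ℝ))⁻¹ • v))
  gcongr

/-! ### Principal submatrices and the deterministic oracle property -/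

lemma Matrix.tendsto_inv_of_det_ne_zero {ι α : Type*} [Fintype ι] [DecidableEq ι] {l : Filter α}
    {A : α → Matrix ι ι ℝ} {C : Matrix ι ι ℝ} (hA : Tendsto A l (𝓝 C)) (hC : C.det ≠ 0) :
    Tendsto (fun n => (A n)⁻¹) l (𝓝 C⁻¹) := by
  simp only [Matrix.inv_def, Ring.inverse_eq_inv']
  refine Tendsto.smul (Tendsto.inv₀ ?_ hC) ?_
  · exact ((continuous_id.matrix_det).tendsto C).comp hA
  · exact ((continuous_id.matrix_adjugate).tendsto C).comp hA

lemma tendsto_principalSubmatrix {p : ℕ} {α : Type*} {l : Filter α} (S : Finset (Fin p))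
    {A : α → Matrix (Fin p) (Fin p) ℝ} {C : Matrix (Fin p) (Fin p) ℝ} (hA : Tendsto A l (𝓝 C)) :
    Tendsto (fun n => principalSubmatrix S (A n)) l (𝓝 (principalSubmatrix S C)) :=
  ((continuous_id.matrix_submatrix _ _).tendsto C).comp hA

lemma Matrix.PosDef.principalSubmatrix {p : ℕ} {C : Matrix (Fin p) (Fin p) ℝ} (hC : C.PosDef)
    (S : Finset (Fin p)) : (principalSubmatrix S C).PosDef :=
  hC.submatrix Subtype.val_injective

lemma principalSubmatrix_mulVec_of_eq_zero {p : ℕ} (S : Finset (Fin p))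
    (A : Matrix (Fin p) (Fin p) ℝ) {u : Fin p → ℝ} (hu : ∀ j ∉ S, u j = 0) (i : S) :
    (principalSubmatrix S A *ᵥ fun j : S => u j) i = (A *ᵥ u) i := by
  simp only [principalSubmatrix, Matrix.mulVec, dotProduct, Matrix.submatrix_apply]
  rw [Finset.sum_coe_sort S (fun j => A i j * u j)]
  exact Finset.sum_subset (Finset.subset_univ S) fun j _ hj => by simp [hu j hj]

/-- The value of the rescaled Transfer Lasso error on the active set `S` once the source parameter
identifies the active set: `(C_n)_SS⁻¹ (w_S - a / 2 • s_S)`, with `w` the normalized score. -/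
noncomputable def oracleError {n p : ℕ} (X : Matrix (Fin n) (Fin p) ℝ)
    (βs : EuclideanSpace ℝ (Fin p)) (a : ℝ) (ε : EuclideanSpace ℝ (Fin n)) :
    EuclideanSpace ℝ (activeSet βs) :=
  WithLp.toLp 2 ((principalSubmatrix (activeSet βs) ((1 / (n : ℝ)) • (Xᵀ * X)))⁻¹ *ᵥ
    fun j : activeSet βs => normalizedScore X ε j - a / 2 * (SignType.sign (βs j) : ℝ))

lemma IsTransferLasso.oracle {n p : ℕ} (hn : 0 < n) {X : Matrix (Fin n) (Fin p) ℝ}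
    {βs βt b : EuclideanSpace ℝ (Fin p)} {ε : EuclideanSpace ℝ (Fin n)} {lam eta : ℝ}
    (hST : activeSet βs = changeSet βt βs)
    (hsign : ∀ j ∈ activeSet βs, SignType.sign (βt j - βs j) = SignType.sign (βs j))
    (hlam : 0 ≤ lam) (heta : 0 ≤ eta) (ha : |(lam - eta) / √(n : ℝ)| ≤ 1) {c K M : ℝ}
    (hc : 0 < c) (hM : 0 ≤ M)
    (hAc : ∀ v : Fin p → ℝ, c * (∑ j, |v j|) ^ 2 ≤ v ⬝ᵥ ((1 / (n : ℝ)) • (Xᵀ * X)) *ᵥ v)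
    (hK : ∀ i j, |((1 / (n : ℝ)) • (Xᵀ * X)) i j| ≤ K)
    (hdet : (principalSubmatrix (activeSet βs) ((1 / (n : ℝ)) • (Xᵀ * X))).det ≠ 0)
    (hadd : 3 * (K * ((2 * M + 1) / c)) + 2 * M < (lam + eta) / √(n : ℝ))
    (hβs : ∀ j ∈ activeSet βs, (2 * M + 1) / c + 1 ≤ √(n : ℝ) * |βs j|)
    (hβt : ∀ j ∈ activeSet βs, (2 * M + 1) / c + 1 ≤ √(n : ℝ) * |βt j - βs j|)
    (hw : ∀ j, |normalizedScore X ε j| ≤ M)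
    (h : IsTransferLasso X (linearResponse X βs ε) βt lam eta b) :
    activeSet b = activeSet βs ∧ changeSet βt b = changeSet βt βs ∧
      √(n : ℝ) • restrictTo (activeSet βs) (b - βs)
        = oracleError X βs ((lam - eta) / √(n : ℝ)) ε := by
  have hr : (0 : ℝ) < √(n : ℝ) := Real.sqrt_pos.2 (by exact_mod_cast hn)
  have hA : ((1 / (n : ℝ)) • (Xᵀ * X)).IsSymm := by
    simp [Matrix.IsSymm, Matrix.transpose_smul, Matrix.transpose_mul]
  have hsc : ∀ j ∉ activeSet βs, βs j = 0 ∧ βt j = 0 := fun j hj => by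
    have h0 : βs j = 0 := by simpa [activeSet] using hj
    rw [hST] at hj
    have h1 : βt j = βs j := by simpa [changeSet] using hj
    exact ⟨h0, h1.trans h0⟩
  have hmin := h.penalizedQuadratic_le hn
  set u : Fin p → ℝ := √(n : ℝ) • (b - βs).ofLp with hu
  have hpenSc : ∀ j ∉ activeSet βs, ∀ x, transferPenalty βs βt lam eta √(n : ℝ) j x
      = (lam + eta) / √(n : ℝ) * |x| := fun j hj =>
    transferPenalty_of_eq_zero hr (hsc j hj).1 (hsc j hj).2
  have hR : ∑ j, |u j| ≤ (2 * M + 1) / c := by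
    refine sum_abs_le_of_penalizedQuadratic_min (S := activeSet βs)
      (s := fun j => (SignType.sign (βs j) : ℝ)) (a := (lam - eta) / √(n : ℝ))
      (b := (lam + eta) / √(n : ℝ)) (fun j => ?_) ha (by positivity) hc hM hAc hw
      (fun j => by simp [transferPenalty])
      (fun j hj x => le_transferPenalty hlam heta (hsign j hj) x) hpenSc hmin
    rcases lt_trichotomy (βs j) 0 with hj | hj | hj <;> simp [hj]
  have huj : ∀ j, |u j| < (2 * M + 1) / c + 1 := fun j =>
    ((Finset.single_le_sum (f := fun k => |u k|) (fun _ _ => abs_nonneg _)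
      (Finset.mem_univ j)).trans hR).trans_lt (lt_add_one _)
  have hzero : ∀ j ∉ activeSet βs, u j = 0 := fun j hj =>
    eq_zero_of_penalizedQuadratic_min hA hK hw hR hadd (hpenSc j hj) hmin
  have hb : ∀ j, u j = √(n : ℝ) * (b j - βs j) := fun j => by simp [hu]
  have hbzero : ∀ j ∉ activeSet βs, b j = 0 := fun j hj => by
    have := hzero j hj
    rw [hb, mul_eq_zero, or_iff_right hr.ne', (hsc j hj).1, sub_zero] at this
    exact this
  -- If `b j = y`, then `|u j| = √n |y - βs j|` would exceed the bound `huj`. Used with `y = 0` for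
  -- the active set and `y = βt j` for the change set.
  have hne : ∀ y, ∀ j, (2 * M + 1) / c + 1 ≤ √(n : ℝ) * |y - βs j| → y ≠ b j := by
    rintro y j hy rfl
    have := huj j
    rw [hb, abs_mul, abs_of_pos hr] at this
    exact absurd (this.trans_le hy) (lt_irrefl _)
  refine ⟨?_, ?_, ?_⟩
  · ext j
    by_cases hj : j ∈ activeSet βs
    · refine iff_of_true ?_ hj
      have := hne 0 j (by simpa using hβs j hj)
      simpa [activeSet] using this.symm
    · refine iff_of_false ?_ hj
      simp [activeSet, hbzero j hj]
  · rw [← hST]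
    ext j
    by_cases hj : j ∈ activeSet βs
    · refine iff_of_true ?_ hj
      simpa [changeSet] using hne (βt j) j (hβt j hj)
    · refine iff_of_false ?_ hj
      simp [changeSet, hbzero j hj, (hsc j hj).2]
  -- Since `u` vanishes off the active set, the first order conditions there form a closed linear
  -- system.
  · have hSS : principalSubmatrix (activeSet βs) ((1 / (n : ℝ)) • (Xᵀ * X)) *ᵥ
        (fun j : activeSet βs => u j) = fun j : activeSet βs => normalizedScore X ε j
          - (lam - eta) / √(n : ℝ) / 2 * (SignType.sign (βs j) : ℝ) := by
      funext i
      rw [principalSubmatrix_mulVec_of_eq_zero _ _ hzero]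
      exact mulVec_eq_of_penalizedQuadratic_min (s := fun j => (SignType.sign (βs j) : ℝ)) hA
        (huj i) (fun x hx => transferPenalty_eq_of_abs_lt hr (hsign i i.2)
          (hx.trans_le (hβs i i.2)) (hx.trans_le (hβt i i.2))) hmin
    rw [oracleError, ← hSS, Matrix.mulVec_mulVec, Matrix.nonsing_inv_mul _ hdet.isUnit,
      Matrix.one_mulVec]
    ext j
    simp [restrictTo, hu]

/-- For large `n`, whenever the normalized score is bounded by `M`, the Transfer Lasso recovers the
active set and the change set, and its rescaled error on the active set is `oracleError`. -/
lemma eventually_isTransferLasso_oracle {p : ℕ}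
    {X : (n : ℕ) → Matrix (Fin n) (Fin p) ℝ} {C : Matrix (Fin p) (Fin p) ℝ} (hC : C.PosDef)
    (hX : Tendsto (fun n : ℕ => (1 / (n : ℝ)) • ((X n)ᵀ * X n)) atTop (𝓝 C))
    {βs βt : EuclideanSpace ℝ (Fin p)} (hST : activeSet βs = changeSet βt βs)
    (hsign : ∀ j ∈ activeSet βs, SignType.sign (βt j - βs j) = SignType.sign (βs j))
    {lam eta : ℕ → ℝ}
    (hadd : Tendsto (fun n : ℕ => (lam n + eta n) / √(n : ℝ)) atTop atTop)
    (hsub : Tendsto (fun n : ℕ => (lam n - eta n) / √(n : ℝ)) atTop (𝓝 0)) {M : ℝ} (hM : 0 ≤ M) :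
    ∀ᶠ n in atTop, ∀ (ε : EuclideanSpace ℝ (Fin n)) (b : EuclideanSpace ℝ (Fin p)),
      (∀ j, |normalizedScore (X n) ε j| ≤ M) →
      IsTransferLasso (X n) (linearResponse (X n) βs ε) βt (lam n) (eta n) b →
      activeSet b = activeSet βs ∧ changeSet βt b = changeSet βt βs ∧
        √(n : ℝ) • restrictTo (activeSet βs) (b - βs)
          = oracleError (X n) βs ((lam n - eta n) / √(n : ℝ)) ε := by
  obtain ⟨c, hc, hAc⟩ := hC.exists_eventually_mul_sq_sum_abs_le hX
  obtain ⟨K, hK⟩ := exists_eventually_abs_apply_le hX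
  have hdet : ∀ᶠ n : ℕ in atTop, (principalSubmatrix (activeSet βs)
      ((1 / (n : ℝ)) • ((X n)ᵀ * X n))).det ≠ 0 :=
    (((continuous_id.matrix_det).tendsto _).comp
      (tendsto_principalSubmatrix (activeSet βs) hX)).eventually_ne
      (hC.principalSubmatrix _).det_pos.ne'
  have hsqrt : Tendsto (fun n : ℕ => √(n : ℝ)) atTop atTop :=
    Real.tendsto_sqrt_atTop.comp tendsto_natCast_atTop_atTop
  have hlarge : ∀ x : Fin p → ℝ, (∀ j ∈ activeSet βs, x j ≠ 0) → ∀ᶠ n : ℕ in atTop,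
      ∀ j ∈ activeSet βs, (2 * M + 1) / c + 1 ≤ √(n : ℝ) * |x j| := fun x hx =>
    (Finset.eventually_all _).2 fun j hj =>
      (hsqrt.atTop_mul_const (abs_pos.2 (hx j hj))).eventually_ge_atTop _
  have hβs := hlarge (fun j => βs j) fun j hj => by simpa [activeSet] using hj
  have hβt := hlarge (fun j => βt j - βs j) fun j hj => by
    rw [hST] at hj
    simpa [changeSet, sub_eq_zero] using hj
  have hsub1 : ∀ᶠ n : ℕ in atTop, |(lam n - eta n) / √(n : ℝ)| ≤ 1 := by
    filter_upwards [hsub.abs.eventually_le_const (u := 1) (by simp)] with n hn using hn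
  filter_upwards [hAc, hK, hdet, hβs, hβt, hsub1, hadd.eventually_ge_atTop 1,
    hadd.eventually_gt_atTop (3 * (K * ((2 * M + 1) / c)) + 2 * M), eventually_gt_atTop 0]
    with n h1 h2 h3 h4 h5 h6 h7 h8 hn ε b hw hb
  have hr : (0 : ℝ) < √(n : ℝ) := Real.sqrt_pos.2 (by exact_mod_cast hn)
  -- `|lam n - eta n| ≤ √n ≤ lam n + eta n` forces both parameters to be nonnegative.
  have h9 := h6
  rw [abs_div, abs_of_pos hr, div_le_one hr, abs_le] at h9
  rw [le_div_iff₀ hr] at h7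
  exact hb.oracle hn hST hsign (by linarith [h9.1]) (by linarith [h9.2]) h6 hc hM h1 h2 h3 h8 h4
    h5 hw

/-! ### Gaussian sums and asymptotically negligible events -/

/-- A linear combination of i.i.d. centred Gaussian variables is Gaussian. -/
lemma hasLaw_sum_mul_gaussianReal {Ω ι : Type*} [MeasurableSpace Ω] [Fintype ι] {P : Measure Ω}
    [IsProbabilityMeasure P] {v : ℝ≥0} {X : ι → Ω → ℝ}
    (hX : ∀ i, HasLaw (X i) (gaussianReal 0 v) P) (hindep : iIndepFun X P) (c : ι → ℝ) :
    HasLaw (fun ω => ∑ i, c i * X i ω) (gaussianReal 0 (v * ∑ i, ‖c i‖₊ ^ 2)) P := by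
  have hm : ∀ i, AEMeasurable (fun ω => c i * X i ω) P := fun i =>
    (hX i).aemeasurable.const_mul _
  have hi : iIndepFun (fun i ω => c i * X i ω) P :=
    hindep.comp (fun i x => c i * x) fun i => measurable_const_mul _
  have hl : ∀ i, P.map (fun ω => c i * X i ω) = gaussianReal 0 (‖c i‖₊ ^ 2 * v) := fun i => by
    have := gaussianReal_const_mul (hX i) (c i)
    rw [mul_zero] at this
    rw [this.map_eq]
    congr 2
    ext
    simp
  refine ⟨Finset.aemeasurable_fun_sum _ fun i _ => hm i, ?_⟩
  have : IsProbabilityMeasure (P.map fun ω => ∑ i, c i * X i ω) :=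
    Measure.isProbabilityMeasure_map (Finset.aemeasurable_fun_sum _ fun i _ => hm i)
  refine Measure.ext_of_charFun ?_
  rw [hi.charFun_map_fun_sum_eq_prod hm]
  ext t
  simp only [Finset.prod_apply, hl, charFun_gaussianReal, ← Complex.exp_sum]
  congr 1
  push_cast
  simp only [mul_zero, zero_mul, zero_sub, Finset.sum_neg_distrib, Finset.mul_sum, Finset.sum_mul,
    Finset.sum_div]
  congr 1
  refine Finset.sum_congr rfl fun i _ => ?_
  ring

/-- Chebyshev's inequality for a centred Gaussian variable. -/
lemma measure_lt_abs_le_of_hasLaw_gaussianReal {Ω : Type*} [MeasurableSpace Ω] {P : Measure Ω}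
    [IsProbabilityMeasure P] {v : ℝ≥0} {Y : Ω → ℝ} (hY : HasLaw Y (gaussianReal 0 v) P)
    {M : ℝ} (hM : 0 < M) : P {ω | M < |Y ω|} ≤ ENNReal.ofReal (v / M ^ 2) := by
  have h2 : MemLp Y 2 P := by
    have := memLp_id_gaussianReal (μ := 0) (v := v) 2
    rw [← hY.map_eq] at this
    simpa using this.comp_of_map hY.aemeasurable
  have h := meas_ge_le_variance_div_sq h2 hM
  rw [hY.variance_eq, variance_id_gaussianReal, hY.integral_eq, integral_id_gaussianReal] at h
  refine (measure_mono fun ω hω => ?_).trans h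
  have hω : M < |Y ω| := hω
  simpa using hω.le

/-- Two random vectors which differ with small probability have close characteristic functions. -/
lemma norm_charFun_map_sub_le {Ω E : Type*} [MeasurableSpace Ω] [NormedAddCommGroup E]
    [InnerProductSpace ℝ E] [MeasurableSpace E] [BorelSpace E] [SecondCountableTopology E]
    {P : Measure Ω} [IsProbabilityMeasure P] {Y Z : Ω → E} (hY : AEMeasurable Y P)
    (hZ : AEMeasurable Z P) (t : E) :
    ‖charFun (P.map Y) t - charFun (P.map Z) t‖ ≤ 2 * P.real {ω | Y ω ≠ Z ω} := by
  have hint : ∀ {W : Ω → E}, AEMeasurable W P →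
      Integrable (fun ω => Complex.exp (inner ℝ (W ω) t * Complex.I)) P := fun {W} hW => by
    refine Integrable.of_bound (C := 1) (AEMeasurable.aestronglyMeasurable (by fun_prop)) ?_
    exact ae_of_all _ fun ω => (Complex.norm_exp_ofReal_mul_I _).le
  rw [charFun_apply, charFun_apply, integral_map hY (by fun_prop), integral_map hZ (by fun_prop),
    ← integral_sub (hint hY) (hint hZ)]
  -- The integrands agree off `B` and differ by at most `2` on it; the measurable hull has the same
  -- measure as the disagreement set.
  set B := toMeasurable P {ω | Y ω ≠ Z ω}
  have hB : MeasurableSet B := measurableSet_toMeasurable _ _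
  calc _ ≤ ∫ ω, B.indicator (fun _ => (2 : ℝ)) ω ∂P := by
        refine norm_integral_le_of_norm_le ((integrable_const _).indicator hB) ?_
        refine ae_of_all _ fun ω => ?_
        by_cases hω : ω ∈ B
        · rw [Set.indicator_of_mem hω]
          refine (norm_sub_le _ _).trans ?_
          rw [Complex.norm_exp_ofReal_mul_I, Complex.norm_exp_ofReal_mul_I]
          norm_num
        · have : Y ω = Z ω := by
            by_contra hne
            exact hω (subset_toMeasurable _ _ hne)
          simp [Set.indicator_of_notMem hω, this]
    _ = 2 * P.real {ω | Y ω ≠ Z ω} := by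
        rw [integral_indicator_const _ hB, smul_eq_mul, mul_comm, Measure.real, Measure.real,
          measure_toMeasurable]

/-- If events fail with asymptotic probability at most `B / M ^ 2` for each `M`, their complements
have vanishing probability. -/
lemma tendsto_measure_zero_of_eventually_le_div_sq {Ω : ℕ → Type*} [∀ n, MeasurableSpace (Ω n)]
    {P : (n : ℕ) → Measure (Ω n)} {E : (n : ℕ) → Set (Ω n)} {B : ℝ}
    (h : ∀ M > 0, ∀ᶠ n in atTop, P n (E n) ≤ ENNReal.ofReal (B / M ^ 2)) :
    Tendsto (fun n => P n (E n)) atTop (𝓝 0) := by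
  have hlim : Tendsto (fun M : ℝ => ENNReal.ofReal (B / M ^ 2)) atTop (𝓝 0) := by
    rw [← ENNReal.ofReal_zero]
    exact ENNReal.tendsto_ofReal (tendsto_const_nhds.div_atTop (tendsto_pow_atTop two_ne_zero))
  rw [ENNReal.tendsto_nhds_zero]
  intro δ hδ
  obtain ⟨M, hM, hM0⟩ := ((hlim.eventually_lt_const hδ).and (eventually_gt_atTop 0)).exists
  filter_upwards [h M hM0] with n hn using hn.trans hM.le

/-- Subadditivity replaces the complement formula, so the events need not be measurable. -/
lemma tendsto_measure_one_of_compl {Ω : ℕ → Type*} [∀ n, MeasurableSpace (Ω n)]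
    {P : (n : ℕ) → Measure (Ω n)} [∀ n, IsProbabilityMeasure (P n)] {E F : (n : ℕ) → Set (Ω n)}
    (hEF : ∀ n, (F n)ᶜ ⊆ E n) (h : Tendsto (fun n => P n (F n)) atTop (𝓝 0)) :
    Tendsto (fun n => P n (E n)) atTop (𝓝 1) := by
  have h1 : Tendsto (fun n => 1 - P n (F n)) atTop (𝓝 1) := by
    simpa using ENNReal.Tendsto.sub tendsto_const_nhds h (Or.inl ENNReal.one_ne_top)
  refine tendsto_of_tendsto_of_tendsto_of_le_of_le h1 tendsto_const_nhds (fun n => ?_)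
    fun n => prob_le_one
  rw [tsub_le_iff_right]
  calc (1 : ENNReal) = P n Set.univ := measure_univ.symm
    _ ≤ P n (E n ∪ F n) := measure_mono fun ω _ => by
        by_cases hω : ω ∈ F n
        · exact Or.inr hω
        · exact Or.inl (hEF n hω)
    _ ≤ _ := measure_union_le _ _

/-! ### The law of the normalized score and of the oracle error -/

section Score

variable {n p : ℕ} {Ω : Type*} [MeasurableSpace Ω] {P : Measure Ω} [IsProbabilityMeasure P]
  {σ : ℝ≥0} {ε : Ω → EuclideanSpace ℝ (Fin n)}

lemma sum_mul_normalizedScore {ι : Type*} [Fintype ι] (X : Matrix (Fin n) (Fin p) ℝ)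
    (e : EuclideanSpace ℝ (Fin n)) (f : ι → Fin p) (t : ι → ℝ) :
    ∑ j, t j * normalizedScore X e (f j) = ∑ i, (∑ j, t j * (X i (f j) / √(n : ℝ))) * e i := by
  simp only [normalizedScore, Finset.mul_sum, Finset.sum_mul]
  rw [Finset.sum_comm]
  simp only [mul_assoc]

/-- Up to the factor `σ ^ 2`, this is the variance of a linear combination of scores. -/
lemma sum_sq_sum_mul_div_sqrt {ι : Type*} [Fintype ι] (X : Matrix (Fin n) (Fin p) ℝ)
    (f : ι → Fin p) (t : ι → ℝ) :
    ∑ i, (∑ j, t j * (X i (f j) / √(n : ℝ))) ^ 2 =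
      t ⬝ᵥ ((1 / (n : ℝ)) • (Xᵀ * X)).submatrix f f *ᵥ t := by
  have hrr : (√(n : ℝ))⁻¹ * (√(n : ℝ))⁻¹ = 1 / n := by
    rw [← mul_inv, Real.mul_self_sqrt n.cast_nonneg, one_div]
  simp only [dotProduct, Matrix.mulVec, Matrix.submatrix_apply, Matrix.smul_apply,
    Matrix.mul_apply, Matrix.transpose_apply, smul_eq_mul, sq, Finset.mul_sum,
    Finset.sum_mul]
  rw [Finset.sum_comm]
  refine Finset.sum_congr rfl fun j _ => ?_
  rw [Finset.sum_comm]
  refine Finset.sum_congr rfl fun k _ => Finset.sum_congr rfl fun i _ => ?_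
  rw [← hrr]
  ring

/-- Linear combinations of the normalized score are Gaussian. -/
lemma exists_hasLaw_sum_mul_normalizedScore {ι : Type*} [Fintype ι]
    (hlaw : ∀ i : Fin n, HasLaw (fun ω => ε ω i) (gaussianReal 0 (σ ^ 2)) P)
    (hindep : iIndepFun (fun (i : Fin n) ω => ε ω i) P) (X : Matrix (Fin n) (Fin p) ℝ)
    (f : ι → Fin p) (t : ι → ℝ) :
    ∃ v : ℝ≥0, HasLaw (fun ω => ∑ j, t j * normalizedScore X (ε ω) (f j)) (gaussianReal 0 v) P ∧
      (v : ℝ) = σ ^ 2 * (t ⬝ᵥ ((1 / (n : ℝ)) • (Xᵀ * X)).submatrix f f *ᵥ t) := by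
  refine ⟨σ ^ 2 * ∑ i, ‖∑ j, t j * (X i (f j) / √(n : ℝ))‖₊ ^ 2, ?_, ?_⟩
  · simp only [sum_mul_normalizedScore]
    exact hasLaw_sum_mul_gaussianReal hlaw hindep _
  · push_cast
    rw [← sum_sq_sum_mul_div_sqrt]
    simp

lemma exists_hasLaw_normalizedScore
    (hlaw : ∀ i : Fin n, HasLaw (fun ω => ε ω i) (gaussianReal 0 (σ ^ 2)) P)
    (hindep : iIndepFun (fun (i : Fin n) ω => ε ω i) P) (X : Matrix (Fin n) (Fin p) ℝ)
    (j : Fin p) :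
    ∃ v : ℝ≥0, HasLaw (fun ω => normalizedScore X (ε ω) j) (gaussianReal 0 v) P ∧
      (v : ℝ) = σ ^ 2 * ((1 / (n : ℝ)) • (Xᵀ * X)) j j := by
  obtain ⟨v, hv, hv'⟩ := exists_hasLaw_sum_mul_normalizedScore hlaw hindep X
    (fun _ : Unit => j) (fun _ => 1)
  refine ⟨v, by simpa using hv, ?_⟩
  rw [hv']
  simp [dotProduct, Matrix.mulVec]

/-- The score exceeds `M` with probability `O(1 / M ^ 2)`. -/
lemma measure_exists_lt_abs_normalizedScore_le
    (hlaw : ∀ i : Fin n, HasLaw (fun ω => ε ω i) (gaussianReal 0 (σ ^ 2)) P)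
    (hindep : iIndepFun (fun (i : Fin n) ω => ε ω i) P) {X : Matrix (Fin n) (Fin p) ℝ} {K : ℝ}
    (hK : ∀ i j, |((1 / (n : ℝ)) • (Xᵀ * X)) i j| ≤ K) {M : ℝ} (hM : 0 < M) :
    P {ω | ∃ j, M < |normalizedScore X (ε ω) j|} ≤ ENNReal.ofReal (p * (σ ^ 2 * K) / M ^ 2) := by
  calc P {ω | ∃ j, M < |normalizedScore X (ε ω) j|}
      ≤ ∑ j, P {ω | M < |normalizedScore X (ε ω) j|} := by
        refine (measure_mono fun ω hω => ?_).trans (measure_iUnion_fintype_le P _)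
        simpa using hω
    _ ≤ ∑ _j : Fin p, ENNReal.ofReal (σ ^ 2 * K / M ^ 2) := by
        refine Finset.sum_le_sum fun j _ => ?_
        obtain ⟨v, hv, hv'⟩ := exists_hasLaw_normalizedScore hlaw hindep X j
        refine (measure_lt_abs_le_of_hasLaw_gaussianReal hv hM).trans ?_
        rw [hv']
        gcongr
        exact (le_abs_self _).trans (hK j j)
    _ = ENNReal.ofReal (p * (σ ^ 2 * K) / M ^ 2) := by
        rw [Finset.sum_const, Finset.card_univ, Fintype.card_fin, nsmul_eq_mul,
          mul_div_assoc (p : ℝ), ENNReal.ofReal_mul p.cast_nonneg, ENNReal.ofReal_natCast]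

lemma aemeasurable_oracleError
    (hlaw : ∀ i : Fin n, HasLaw (fun ω => ε ω i) (gaussianReal 0 (σ ^ 2)) P)
    (hindep : iIndepFun (fun (i : Fin n) ω => ε ω i) P) (X : Matrix (Fin n) (Fin p) ℝ)
    (βs : EuclideanSpace ℝ (Fin p)) (a : ℝ) :
    AEMeasurable (fun ω => oracleError X βs a (ε ω)) P := by
  refine (PiLp.continuous_toLp 2 _).measurable.comp_aemeasurable
    (aemeasurable_pi_lambda _ fun i => ?_)
  simp only [Matrix.mulVec, dotProduct]
  refine Finset.aemeasurable_fun_sum _ fun j _ => ?_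
  obtain ⟨v, hv, -⟩ := exists_hasLaw_normalizedScore hlaw hindep X j
  exact (hv.aemeasurable.sub_const _).const_mul _

/-- The characteristic function of the oracle error. -/
lemma charFun_map_oracleError
    (hlaw : ∀ i : Fin n, HasLaw (fun ω => ε ω i) (gaussianReal 0 (σ ^ 2)) P)
    (hindep : iIndepFun (fun (i : Fin n) ω => ε ω i) P) (X : Matrix (Fin n) (Fin p) ℝ)
    (βs : EuclideanSpace ℝ (Fin p)) (a : ℝ) (t : EuclideanSpace ℝ (activeSet βs)) :
    charFun (P.map fun ω => oracleError X βs a (ε ω)) t =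
      Complex.exp ((-(a / 2 * (t ⬝ᵥ (principalSubmatrix (activeSet βs)
          ((1 / (n : ℝ)) • (Xᵀ * X)))⁻¹ *ᵥ fun j => (SignType.sign (βs j) : ℝ))) : ℝ) * Complex.I
        - (σ ^ 2 * ((t ᵥ* (principalSubmatrix (activeSet βs) ((1 / (n : ℝ)) • (Xᵀ * X)))⁻¹) ⬝ᵥ
          (principalSubmatrix (activeSet βs) ((1 / (n : ℝ)) • (Xᵀ * X))) *ᵥ
          (t ᵥ* (principalSubmatrix (activeSet βs) ((1 / (n : ℝ)) • (Xᵀ * X)))⁻¹)) / 2 : ℝ)) := by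
  set D := principalSubmatrix (activeSet βs) ((1 / (n : ℝ)) • (Xᵀ * X)) with hD
  set m : ℝ := -(a / 2 * (t ⬝ᵥ D⁻¹ *ᵥ fun j => (SignType.sign (βs j) : ℝ))) with hm
  obtain ⟨v, hv, hv'⟩ := exists_hasLaw_sum_mul_normalizedScore hlaw hindep X
    (fun j : activeSet βs => (j : Fin p)) (t.ofLp ᵥ* D⁻¹)
  -- Pairing with `t` leaves a centred Gaussian combination of scores with weights `t ᵥ* D⁻¹`,
  -- shifted by the constant `m`.
  have hin : ∀ ω, inner ℝ (oracleError X βs a (ε ω)) t =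
      ∑ j : activeSet βs, (t.ofLp ᵥ* D⁻¹) j * normalizedScore X (ε ω) j + m := fun ω => by
    have h1 : inner ℝ (oracleError X βs a (ε ω)) t = t.ofLp ⬝ᵥ (oracleError X βs a (ε ω)).ofLp := by
      simp [PiLp.inner_apply, dotProduct]
    have h2 : (fun j : activeSet βs => normalizedScore X (ε ω) j
        - a / 2 * (SignType.sign (βs j) : ℝ)) = (fun j : activeSet βs => normalizedScore X (ε ω) j)
        - (a / 2) • fun j : activeSet βs => (SignType.sign (βs j) : ℝ) := rfl
    rw [h1, oracleError, h2, ← hD, Matrix.mulVec_sub, Matrix.mulVec_smul, dotProduct_sub,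
      dotProduct_smul, Matrix.dotProduct_mulVec, hm, smul_eq_mul]
    rfl
  have hchar := charFun_gaussianReal (μ := 0) (v := v) 1
  rw [← hv.map_eq, charFun_apply_real, integral_map hv.aemeasurable (by fun_prop)] at hchar
  rw [charFun_apply, integral_map (aemeasurable_oracleError hlaw hindep X βs a) (by fun_prop)]
  simp only [hin]
  have hsplit : ∀ x : ℝ, Complex.exp (((x + m : ℝ) : ℂ) * Complex.I)
      = Complex.exp (((1 : ℝ) : ℂ) * x * Complex.I) * Complex.exp (m * Complex.I) := fun x => by
    rw [← Complex.exp_add]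
    congr 1
    push_cast
    ring
  simp only [hsplit]
  rw [integral_mul_const, hchar, ← Complex.exp_add]
  congr 1
  -- `D` may be singular at this `n`, so the variance keeps `D⁻¹`, `D`, `D⁻¹` uncancelled.
  have hv'' : (v : ℝ) = σ ^ 2 * ((t.ofLp ᵥ* D⁻¹) ⬝ᵥ D *ᵥ (t.ofLp ᵥ* D⁻¹)) := hv'
  rw [← hv'']
  push_cast
  ring

end Score

/-! ### Passage to the limit -/

/-- The characteristic functions of the oracle errors converge to the Gaussian one. -/
lemma tendsto_charFun_map_oracleError {p : ℕ}
    {X : (n : ℕ) → Matrix (Fin n) (Fin p) ℝ} {C : Matrix (Fin p) (Fin p) ℝ} (hC : C.PosDef)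
    (hX : Tendsto (fun n : ℕ => (1 / (n : ℝ)) • ((X n)ᵀ * X n)) atTop (𝓝 C))
    {Ω : ℕ → Type*} [∀ n, MeasurableSpace (Ω n)]
    {P : (n : ℕ) → Measure (Ω n)} [∀ n, IsProbabilityMeasure (P n)]
    {σ : ℝ≥0} {ε : (n : ℕ) → Ω n → EuclideanSpace ℝ (Fin n)}
    (hlaw : ∀ n (i : Fin n), HasLaw (fun ω => ε n ω i) (gaussianReal 0 (σ ^ 2)) (P n))
    (hindep : ∀ n, iIndepFun (fun (i : Fin n) ω => ε n ω i) (P n))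
    (βs : EuclideanSpace ℝ (Fin p)) {a : ℕ → ℝ} (ha : Tendsto a atTop (𝓝 0))
    (t : EuclideanSpace ℝ (activeSet βs)) :
    Tendsto (fun n => charFun ((P n).map fun ω => oracleError (X n) βs (a n) (ε n ω)) t) atTop
      (𝓝 (charFun (multivariateGaussian 0
        ((σ : ℝ) ^ 2 • (principalSubmatrix (activeSet βs) C)⁻¹)) t)) := by
  have hCS := hC.principalSubmatrix (activeSet βs)
  have hdet : (principalSubmatrix (activeSet βs) C).det ≠ 0 := hCS.det_pos.ne'
  have hS := tendsto_principalSubmatrix (activeSet βs) hX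
  have hSinv := Matrix.tendsto_inv_of_det_ne_zero hS hdet
  rw [charFun_multivariateGaussian (hCS.inv.posSemidef.smul (sq_nonneg _))]
  simp only [charFun_map_oracleError (hlaw _) (hindep _)]
  refine ((Complex.continuous_exp.tendsto _).comp ?_)
  refine Tendsto.sub ?_ ?_
  · refine Tendsto.mul_const _ ((Complex.continuous_ofReal.tendsto _).comp ?_)
    rw [inner_zero_right]
    have hcont : Continuous fun D : Matrix (activeSet βs) (activeSet βs) ℝ =>
        t ⬝ᵥ D *ᵥ fun j : activeSet βs => (SignType.sign (βs j) : ℝ) := by fun_prop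
    simpa using ((ha.div_const 2).mul ((hcont.tendsto _).comp hSinv)).neg
  · have hcont : Continuous fun D : Matrix (activeSet βs) (activeSet βs) ℝ ×
        Matrix (activeSet βs) (activeSet βs) ℝ =>
        σ ^ 2 * ((t.ofLp ᵥ* D.1) ⬝ᵥ D.2 *ᵥ (t.ofLp ᵥ* D.1)) / 2 := by fun_prop
    have h := (hcont.tendsto _).comp (hSinv.prodMk_nhds hS)
    -- The limit matrix is invertible, so the product of inverse, matrix and inverse collapses here.
    have heq : σ ^ 2 * ((t.ofLp ᵥ* (principalSubmatrix (activeSet βs) C)⁻¹) ⬝ᵥ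
        (principalSubmatrix (activeSet βs) C) *ᵥ
          (t.ofLp ᵥ* (principalSubmatrix (activeSet βs) C)⁻¹)) / 2 =
        (t.ofLp ⬝ᵥ ((σ : ℝ) ^ 2 • (principalSubmatrix (activeSet βs) C)⁻¹) *ᵥ t.ofLp) / 2 := by
      rw [Matrix.dotProduct_mulVec, Matrix.vecMul_vecMul, Matrix.nonsing_inv_mul _ hdet.isUnit,
        Matrix.vecMul_one, Matrix.smul_mulVec, dotProduct_smul, smul_eq_mul,
        Matrix.dotProduct_mulVec, dotProduct_comm]
    rw [heq] at h
    convert (Complex.continuous_ofReal.tendsto _).comp h using 2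
    · simp
    · push_cast
      rfl

theorem mainTheorem12 {p : ℕ}
    -- design matrices, one for each sample size
    (X : (n : ℕ) → Matrix (Fin n) (Fin p) ℝ) (C : Matrix (Fin p) (Fin p) ℝ)
    (hC : C.PosDef)
    (hX : Tendsto (fun n : ℕ => (1 / (n : ℝ)) • ((X n)ᵀ * X n)) atTop (𝓝 C))
    (hXmax : Tendsto
      (fun n : ℕ => 1 / (n : ℝ) * ⨆ i : Fin n, ‖WithLp.toLp 2 (X n i)‖ ^ 2) atTop (𝓝 0))
    -- i.i.d. Gaussian noise with variance `σ ^ 2`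
    {Ω : ℕ → Type*} [∀ n, MeasurableSpace (Ω n)]
    (P : (n : ℕ) → Measure (Ω n)) [∀ n, IsProbabilityMeasure (P n)]
    (σ : ℝ≥0) (ε : (n : ℕ) → Ω n → EuclideanSpace ℝ (Fin n))
    (hε_law : ∀ n (i : Fin n), HasLaw (fun ω => ε n ω i) (gaussianReal 0 (σ ^ 2)) (P n))
    (hε_indep : ∀ n, iIndepFun (fun (i : Fin n) ω => ε n ω i) (P n))
    -- true parameter, deterministic source parameter, and the conditions on them
    (βstar βtilde : EuclideanSpace ℝ (Fin p))
    (hST : activeSet βstar = changeSet βtilde βstar)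
    (hsign : ∀ j ∈ activeSet βstar,
      SignType.sign (βtilde j - βstar j) = SignType.sign (βstar j))
    -- regularization parameters
    (lam eta : ℕ → ℝ)
    (hadd : Tendsto (fun n : ℕ => (lam n + eta n) / √(n : ℝ)) atTop atTop)
    (hsub : Tendsto (fun n : ℕ => (lam n - eta n) / √(n : ℝ)) atTop (𝓝 0))
    -- the Transfer Lasso estimator
    (βhat : (n : ℕ) → Ω n → EuclideanSpace ℝ (Fin p))
    (hβhat_meas : ∀ n, AEMeasurable (βhat n) (P n))
    (hβhat : ∀ n, ∀ᵐ ω ∂(P n),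
      IsTransferLasso (X n) (linearResponse (X n) βstar (ε n ω)) βtilde (lam n) (eta n)
        (βhat n ω)) :
    Tendsto (fun n => P n {ω | activeSet (βhat n ω) = activeSet βstar}) atTop (𝓝 1) ∧
    Tendsto (fun n => P n {ω | changeSet βtilde (βhat n ω) = changeSet βtilde βstar})
      atTop (𝓝 1) ∧
    TendstoInDistribution
      (fun (n : ℕ) ω => √(n : ℝ) • restrictTo (activeSet βstar) (βhat n ω - βstar)) atTop
      (id : EuclideanSpace ℝ (activeSet βstar) → EuclideanSpace ℝ (activeSet βstar)) P
      (multivariateGaussian 0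
        ((σ : ℝ) ^ 2 • (principalSubmatrix (activeSet βstar) C)⁻¹)) := by
  set G : (n : ℕ) → Ω n → EuclideanSpace ℝ (activeSet βstar) := fun n ω =>
    oracleError (X n) βstar ((lam n - eta n) / √(n : ℝ)) (ε n ω)
  set F : (n : ℕ) → Set (Ω n) := fun n => {ω | ¬(activeSet (βhat n ω) = activeSet βstar ∧
    changeSet βtilde (βhat n ω) = changeSet βtilde βstar ∧
    √(n : ℝ) • restrictTo (activeSet βstar) (βhat n ω - βstar) = G n ω)}
  -- For large `n`, almost every failure of the oracle identities forces some score coordinate above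
  -- `M`.
  have hFlim : Tendsto (fun n => P n (F n)) atTop (𝓝 0) := by
    obtain ⟨K, hK⟩ := exists_eventually_abs_apply_le hX
    refine tendsto_measure_zero_of_eventually_le_div_sq (B := p * (σ ^ 2 * K)) fun M hM => ?_
    filter_upwards [hK, eventually_isTransferLasso_oracle hC hX hST hsign hadd hsub hM.le]
      with n hn horacle
    refine le_trans ?_ (measure_exists_lt_abs_normalizedScore_le (hε_law n) (hε_indep n) hn hM)
    refine measure_mono_ae ?_
    filter_upwards [hβhat n] with ω hω hFω
    by_contra hcon
    refine hFω (horacle (ε n ω) _ (fun j => not_lt.1 fun hj => hcon ⟨j, hj⟩) hω)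
  have hmeas : ∀ n : ℕ, AEMeasurable
      (fun ω => √(n : ℝ) • restrictTo (activeSet βstar) (βhat n ω - βstar)) (P n) := fun n => by
    have hcont : Continuous fun b : EuclideanSpace ℝ (Fin p) =>
        √(n : ℝ) • restrictTo (activeSet βstar) (b - βstar) := by
      unfold restrictTo
      fun_prop
    exact hcont.measurable.comp_aemeasurable (hβhat_meas n)
  refine ⟨tendsto_measure_one_of_compl (fun n ω hω => (not_not.1 hω).1) hFlim,
    tendsto_measure_one_of_compl (fun n ω hω => (not_not.1 hω).2.1) hFlim,
    hmeas, aemeasurable_id, ?_⟩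
  refine ProbabilityMeasure.tendsto_of_tendsto_charFun fun t => ?_
  simp only [ProbabilityMeasure.coe_mk, Measure.map_id]
  have hGlim := tendsto_charFun_map_oracleError hC hX hε_law hε_indep βstar hsub t
  -- The rescaled error equals `G n` off `F n`, so the characteristic functions differ by at most `2
  -- * (P n).real (F n)`.
  have hdiff : Tendsto (fun n => charFun ((P n).map
      fun ω => √(n : ℝ) • restrictTo (activeSet βstar) (βhat n ω - βstar)) t
        - charFun ((P n).map (G n)) t) atTop (𝓝 0) := by
    have hreal : Tendsto (fun n => 2 * (P n).real (F n)) atTop (𝓝 0) := by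
      simpa [Measure.real] using
        ((ENNReal.tendsto_toReal ENNReal.zero_ne_top).comp hFlim).const_mul 2
    refine squeeze_zero_norm (fun n => ?_) hreal
    refine (norm_charFun_map_sub_le (hmeas n)
      (aemeasurable_oracleError (hε_law n) (hε_indep n) _ _ _) t).trans ?_
    refine mul_le_mul_of_nonneg_left (measureReal_mono fun ω hω => ?_) zero_le_two
    exact fun h => hω h.2.2
  have hsum := hdiff.add hGlim
  simp only [zero_add] at hsum
  exact hsum.congr fun n => sub_add_cancel _ _
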